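/- Definitions. A group $G$ is \emph{Cayley bounded} if for every generating subset $U\subseteq G$ there is $n\in\mathbb{N}$ such that every element of $G$ is a product of $n$ elements of $U\cup U^{-1}\cup\{1\}$. It has \emph{cofinality $\le\omega$} if it is the union of a strictly increasing chain $H_0<H_1<H_2<\cdots$ of proper subgroups; otherwise it has cofinality $>\omega$. It is \emph{strongly bounded} if it is Cayley bounded and has cofinality $>\omega$. It has \emph{property FA} if every action of $G$ by automorphisms on a simplicial tree fixes a point of the tree (a vertex or the midpoint of an edge). A \emph{non-trivial free product with amalgamation} is a group isomorphic to $A*_C B$ for some embeddings of $C$ into $A$ and into $B$, neither of which is onto. A class $\mathcal{K}$ of groups is a \emph{reduct of an $L_{\omega_1\omega}$-axiomatizable class} if there are a language $L$ obtained from the language $\{1,{}^{-1},\cdot\}$ of groups by adding countably many symbols and a countable set $T$ of $L_{\omega_1\omega}$-sentences such that $\mathcal{K}$ consists exactly of the reducts to $\{1,{}^{-1},\cdot\}$ of the models of $T$. A class $\mathcal{K}$ of groups is \emph{bountiful} if for all infinite groups $G\le H$ with $H\in\mathcal{K}$ there is $K\in\mathcal{K}$ with $G\le K\le H$ and $|K|=|G|$.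 Proposition. Each of the following classes of groups is a reduct of an $L_{\omega_1\omega}$-axiomatizable class: (1) the groups that are not strongly bounded; (2) the groups of cofinality $\le\omega$; (3) the groups that are not Cayley bounded; (4) the groups that are non-trivial free products with amalgamation; likewise the groups that are HNN-extensions (of some base group along an isomorphism between two of its subgroups); likewise the union of these two classes; (5) the groups that admit a homomorphism onto $\mathbb{Z}$. All these classes are bountiful. The class of groups that do not have property FA is bountiful too. -/

import Mathlib

open FirstOrder Cardinal

universe u v w

namespace BountifulGroups

/-! ### The infinitary logic `L_{ω₁ω}` -/

/-- Formulas of `L_{ω₁ω}` over the first-order language `L` with free variables among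
`x₀, …, xₙ₋₁`: atomic formulas, implication, falsity, universal quantification over one element,
and conjunctions of countable families of formulas. The other connectives, the existential
quantifier and countable disjunctions are definable from these. -/
inductive InfFormula (L : FirstOrder.Language.{u, v}) : ℕ → Type (max u v)
  | falsum {n : ℕ} : InfFormula L n
  | equal {n : ℕ} (t₁ t₂ : L.Term (Fin n)) : InfFormula L n
  | rel {n l : ℕ} (R : L.Relations l) (ts : Fin l → L.Term (Fin n)) : InfFormula L n
  | imp {n : ℕ} (φ ψ : InfFormula L n) : InfFormula L n
  | all {n : ℕ} (φ : InfFormula L (n + 1)) : InfFormula L n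
  | conj {n : ℕ} (φ : ℕ → InfFormula L n) : InfFormula L n

/-- Satisfaction of an `L_{ω₁ω}`-formula in an `L`-structure under an assignment `v`. -/
def InfFormula.Realize {L : FirstOrder.Language.{u, v}} (M : Type w) [L.Structure M] :
    {n : ℕ} → InfFormula L n → (Fin n → M) → Prop
  | _, .falsum, _ => False
  | _, .equal t₁ t₂, v => t₁.realize v = t₂.realize v
  | _, .rel R ts, v => FirstOrder.Language.Structure.RelMap R fun i => (ts i).realize v
  | _, .imp φ ψ, v => φ.Realize M v → ψ.Realize M v
  | _, .all φ, v => ∀ x : M, φ.Realize M (Fin.snoc v x)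
  | _, .conj φ, v => ∀ k : ℕ, (φ k).Realize M v

/-- Sentences of `L_{ω₁ω}`. -/
abbrev InfSentence (L : FirstOrder.Language.{u, v}) : Type (max u v) := InfFormula L 0

/-- `M` is a model of the set `T` of `L_{ω₁ω}`-sentences. -/
def IsModel {L : FirstOrder.Language.{u, v}} (M : Type w) [L.Structure M] (T : Set (InfSentence L)) : Prop :=
  ∀ φ ∈ T, φ.Realize M Fin.elim0

/-! ### Groups as first-order structures -/

/-- The function symbols of the language of groups. -/
inductive GroupFunc : ℕ → Type
  | one : GroupFunc 0
  | inv : GroupFunc 1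
  | mul : GroupFunc 2

/-- The language of groups: a constant `1`, a unary `⁻¹` and a binary `·`. -/
def groupLanguage : FirstOrder.Language.{0, 0} where
  Functions := GroupFunc
  Relations := fun _ => Empty

/-- A group, seen as a structure for the language of groups. -/
@[reducible] def groupStructure (G : Type u) [Group G] : groupLanguage.Structure G where
  funMap := fun {n} (f : GroupFunc n) =>
    match n, f with
    | _, .one => fun _ => 1
    | _, .inv => fun x => (x 0)⁻¹
    | _, .mul => fun x => x 0 * x 1
  RelMap := fun r => nomatch r

/-- A class of (abstract) groups. -/
abbrev GroupClass : Type (u + 1) := ∀ (G : Type u) [Group G], Prop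

/-- The class `K` consists exactly of the reducts to the language of groups of the models of a
countable set `T` of `L_{ω₁ω}`-sentences, where the language of `T` is an expansion of the
language of groups by countably many new symbols. -/
def IsReductOfAxiomatizable (K : GroupClass.{u}) : Prop :=
  ∃ (L : FirstOrder.Language.{0, 0}) (T : Set (InfSentence (groupLanguage.sum L))),
    Countable L.Symbols ∧ T.Countable ∧
      ∀ (M : Type u) [S : groupLanguage.Structure M],
        (∃ _ : Group M, groupStructure M = S ∧ K M) ↔ ∃ _ : L.Structure M, IsModel M T

/-- The class `K` is bountiful: for all infinite groups `G ≤ H` with `H` in `K` there is a group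
`N` in `K` with `G ≤ N ≤ H` and `|N| = |G|`. -/
def Bountiful (K : GroupClass.{u}) : Prop :=
  ∀ (H : Type u) [Group H] (G : Subgroup H), Infinite G → K H →
    ∃ N : Subgroup H, G ≤ N ∧ K N ∧ #N = #G

/-! ### The classes of groups -/

/-- For every generating set `U` of `G` there is `n` such that every element of `G` is a product
of `n` elements of `U ∪ U⁻¹ ∪ {1}`. -/
def CayleyBounded (G : Type u) [Group G] : Prop :=
  ∀ U : Set G, Subgroup.closure U = ⊤ →
    ∃ n : ℕ, ∀ g : G, ∃ l : List G,
      l.length = n ∧ (∀ x ∈ l, x ∈ U ∨ x⁻¹ ∈ U ∨ x = 1) ∧ l.prod = g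

/-- Cofinality `≤ ω`: `G` is the union of a strictly increasing chain of proper subgroups indexed
by the natural numbers. -/
def CofinalityLeOmega (G : Type u) [Group G] : Prop :=
  ∃ H : ℕ → Subgroup G, StrictMono H ∧ (∀ n, H n ≠ ⊤) ∧ ∀ g : G, ∃ n, g ∈ H n

/-- Cayley bounded and of cofinality `> ω`. -/
def StronglyBounded (G : Type u) [Group G] : Prop :=
  CayleyBounded G ∧ ¬ CofinalityLeOmega G

/-- `G` is a non-trivial free product with amalgamation `A₀ *_C A₁`: both maps `C → Aᵢ` are
injective, and neither is onto. -/
def IsNontrivialAmalgam (G : Type u) [Group G] : Prop :=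
  ∃ (A : Fin 2 → Type u) (C : Type u) (_ : ∀ i, Group (A i)) (_ : Group C) (φ : ∀ i, C →* A i),
    (∀ i, Function.Injective (φ i)) ∧ (∀ i, ¬ Function.Surjective (φ i)) ∧
      Nonempty (G ≃* Monoid.PushoutI φ)

/-- `G` is an HNN-extension of some base group `B` along an isomorphism between two subgroups
of `B`. -/
def IsHNNExtension (G : Type u) [Group G] : Prop :=
  ∃ (B : Type u) (_ : Group B) (A₁ A₂ : Subgroup B) (φ : A₁ ≃* A₂),
    Nonempty (G ≃* HNNExtension B A₁ A₂ φ)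

/-- `G` has a homomorphism onto `ℤ`. -/
def MapsOntoInt (G : Type u) [Group G] : Prop :=
  ∃ f : G →* Multiplicative ℤ, Function.Surjective f

/-- Property **FA**: every action of `G` by automorphisms on a simplicial tree fixes a point of the
tree. As the action is simplicial, this means that it fixes a vertex or the midpoint of an edge,
i.e. leaves some edge invariant. -/
def PropertyFA (G : Type u) [Group G] : Prop :=
  ∀ (X : Type u) (T : SimpleGraph X), T.IsTree → ∀ ρ : G →* (T ≃g T),
    (∃ x : X, ∀ g : G, ρ g x = x) ∨ ∃ e ∈ T.edgeSet, ∀ g : G, e.map (ρ g) = e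

end BountifulGroups

open BountifulGroups

namespace BountifulGroups

open Language Structure

/-! ### Closing off under countably many operations -/

/-! Two principles carry the theorem. A reduct of an `L_{ω₁ω}`-axiomatizable class is bountiful by
the downward Löwenheim–Skolem argument. Each formula needs only countably many Skolem functions
(`InfFormula.exists_skolem`), so closing an infinite `G` under those of `T` and under the function
symbols keeps its cardinality. The result is a subgroup whose expansion models `T`
(`IsReductOfAxiomatizable.bountiful`). Each class claimed to be such a reduct consists of the groups
carrying a sequence of subsets with an `L_{ω₁ω}`-expressible property
(`Definable.isReductOfAxiomatizable`). The subsets are a chain of subgroups, a generating set, the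
fibres of a map to `ℤ`, the two factors of an amalgam, or the base, associated subgroups and stable
letter of an HNN-extension. Generation is a countable disjunction over word lengths. For amalgams
and HNN-extensions, the normal form theorem and Britton's lemma replace the external construction by
an internal condition: no nonempty reduced word lies in the amalgamated subgroup, respectively in
the base. This is a countable conjunction over word patterns. Failure of FA is witnessed by a tree
outside the group, so there the closing-off is done directly on the disjoint union of group and
tree. -/

/-- The set `t` is closed under the operations in `F`. -/
def ClosedUnderOps {M : Type u} (F : Set (Σ k, (Fin k → M) → M)) (t : Set M) : Prop :=
  ∀ f ∈ F, ∀ x : Fin f.1 → M, (∀ i, x i ∈ t) → f.2 x ∈ t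

theorem ClosedUnderOps.mono {M : Type u} {F F' : Set (Σ k, (Fin k → M) → M)} {t : Set M}
    (h : ClosedUnderOps F' t) (hF : F ⊆ F') : ClosedUnderOps F t :=
  fun f hf => h f (hF hf)

/-- Take the operations in `F` as the function symbols of a language. The substructure generated by
`s` has at most `max ℵ₀ (#s + #F)` elements, which is `#s` for infinite `s`. -/
theorem exists_closedUnderOps {M : Type u} {F : Set (Σ k, (Fin k → M) → M)} (hF : F.Countable)
    (s : Set M) (hs : Infinite s) : ∃ t, s ⊆ t ∧ ClosedUnderOps F t ∧ #t = #s := by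
  let L : FirstOrder.Language.{u, 0} :=
    ⟨fun k => {f : (Fin k → M) → M // ⟨k, f⟩ ∈ F}, fun _ => Empty⟩
  let S : L.Structure M := { funMap := fun f x => f.1 x, RelMap := fun r => nomatch r }
  refine ⟨Substructure.closure L s, Substructure.subset_closure, ?_, ?_⟩
  · intro f hf x hx
    exact (Substructure.closure L s).fun_mem (⟨f.2, hf⟩ : L.Functions f.1) x hx
  · apply le_antisymm
    · have h := Substructure.lift_card_closure_le (L := L) (s := s)
      have hc : Countable (Σ i, L.Functions i) := by
        have := hF.to_subtype
        refine Function.Injective.countable (β := F) (f := fun p => ⟨⟨p.1, p.2.1⟩, p.2.2⟩) ?_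
        rintro ⟨i, f, hf⟩ ⟨j, g, hg⟩ h
        simp only [Subtype.mk.injEq, Sigma.mk.injEq] at h
        obtain ⟨rfl, h⟩ := h
        cases h
        rfl
      have h1 : #(Σ i, L.Functions i) ≤ ℵ₀ := Cardinal.mk_le_aleph0
      have h2 : ℵ₀ ≤ #s := Cardinal.infinite_iff.1 hs
      simp only [Cardinal.lift_id] at h
      refine h.trans (max_le h2 ?_)
      exact (add_le_add le_rfl (h1.trans h2)).trans (Cardinal.add_eq_self h2).le
    · exact Cardinal.mk_le_mk_of_subset Substructure.subset_closure

/-! ### The downward Löwenheim–Skolem theorem for `L_{ω₁ω}` -/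

/-- Tarski–Vaught by induction on the formula. Only universal quantifiers contribute new functions,
and a countable conjunction takes a countable union, so `F` stays countable. -/
theorem InfFormula.exists_skolem {L : FirstOrder.Language.{0, 0}} (M : Type u) [L.Structure M]
    [Nonempty M] {n : ℕ} (φ : InfFormula L n) :
    ∃ F : Set (Σ k, (Fin k → M) → M), F.Countable ∧
      ∀ (N : Type u) [L.Structure N] (j : N ↪[L] M), ClosedUnderOps F (Set.range j) →
        ∀ v : Fin n → N, φ.Realize N v ↔ φ.Realize M (j ∘ v) := by
  induction φ with
  | falsum => exact ⟨∅, Set.countable_empty, fun N _ j _ v => Iff.rfl⟩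
  | equal t₁ t₂ =>
    refine ⟨∅, Set.countable_empty, fun N _ j _ v => ?_⟩
    simp only [InfFormula.Realize, HomClass.realize_term]
    exact j.injective.eq_iff.symm
  | rel R ts =>
    refine ⟨∅, Set.countable_empty, fun N _ j _ v => ?_⟩
    simp only [InfFormula.Realize, HomClass.realize_term]
    exact (j.map_rel R fun i => (ts i).realize v).symm
  | imp φ ψ ihφ ihψ =>
    obtain ⟨F, hF, h⟩ := ihφ
    obtain ⟨F', hF', h'⟩ := ihψ
    refine ⟨F ∪ F', hF.union hF', fun N _ j hj v => ?_⟩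
    simp only [InfFormula.Realize]
    rw [h N j (hj.mono Set.subset_union_left) v, h' N j (hj.mono Set.subset_union_right) v]
  | @all n φ ih =>
    obtain ⟨F, hF, h⟩ := ih
    -- The Skolem function picks a counterexample if there is one, so the single instance at `f v`
    -- already implies the universal statement.
    have hw : ∀ v : Fin n → M, ∃ x : M,
        φ.Realize M (Fin.snoc v x) → ∀ y : M, φ.Realize M (Fin.snoc v y) := by
      intro v
      by_cases hv : ∀ y : M, φ.Realize M (Fin.snoc v y)
      · exact ⟨Classical.arbitrary M, fun _ => hv⟩
      · obtain ⟨x, hx⟩ := not_forall.1 hv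
        exact ⟨x, fun h => absurd h hx⟩
    choose f hf using hw
    refine ⟨insert ⟨n, f⟩ F, hF.insert _, fun N _ j hj v => ?_⟩
    have h' := h N j (hj.mono (Set.subset_insert _ _))
    simp only [InfFormula.Realize]
    constructor
    · intro hN
      obtain ⟨y, hy⟩ := hj ⟨n, f⟩ (Set.mem_insert _ _) (j ∘ v) fun i => ⟨v i, rfl⟩
      apply hf
      have := (h' _).1 (hN y)
      rwa [Fin.comp_snoc, hy] at this
    · intro hM x
      rw [h', Fin.comp_snoc]
      exact hM _
  | conj φ ih =>
    choose F hF h using ih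
    refine ⟨⋃ k, F k, Set.countable_iUnion hF, fun N _ j hj v => ?_⟩
    simp only [InfFormula.Realize]
    exact forall_congr' fun k => h k N j (hj.mono (Set.subset_iUnion F k)) v

/-- A group is determined by its multiplication. This identifies the group provided by an
axiomatization with the subgroup's own structure. -/
theorem groupStructure_injective {M : Type u} :
    Function.Injective fun h : Group M => @groupStructure M h := by
  intro g₁ g₂ h
  refine Group.ext ?_
  ext x y
  have := congrArg (fun S => @funMap groupLanguage M S 2 GroupFunc.mul ![x, y]) h
  exact this

instance : Countable (Σ n, groupLanguage.Functions n) := by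
  refine Function.Injective.countable (β := ℕ) (f := Sigma.fst) ?_
  rintro ⟨n, f⟩ ⟨m, g⟩ h
  cases f <;> cases g <;> simp_all

theorem IsReductOfAxiomatizable.bountiful {K : GroupClass.{u}} (hK : IsReductOfAxiomatizable K) :
    Bountiful K := by
  intro H _ G hG hH
  obtain ⟨L, T, hL, hT, h⟩ := hK
  let S := groupStructure H
  obtain ⟨SL, hmod⟩ := (h H).1 ⟨inferInstance, rfl, hH⟩
  choose F hF hF' using fun φ : InfSentence (groupLanguage.sum L) => φ.exists_skolem H
  have hcL : Countable (Σ n, L.Functions n) :=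
    (Sum.inl_injective : Function.Injective
      (Sum.inl : (Σ n, L.Functions n) → (Σ n, L.Functions n) ⊕ Σ n, L.Relations n)).countable
  obtain ⟨t, hst, ht, hcard⟩ := exists_closedUnderOps
    (F := (⋃ φ ∈ T, F φ) ∪
      (Set.range fun f : Σ n, groupLanguage.Functions n => ⟨f.1, funMap f.2⟩) ∪
      (Set.range fun f : Σ n, L.Functions n => ⟨f.1, funMap f.2⟩))
    (((hT.biUnion fun φ _ => hF φ).union (Set.countable_range _)).union (Set.countable_range _))
    (G : Set H) hG
  have hfun : ∀ {n} (f : groupLanguage.Functions n) (x : Fin n → H), (∀ i, x i ∈ t) →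
      funMap f x ∈ t := fun {n} f x hx => ht ⟨n, funMap f⟩ (Or.inl (Or.inr ⟨⟨n, f⟩, rfl⟩)) x hx
  have hfun' : ∀ {n} (f : L.Functions n) (x : Fin n → H), (∀ i, x i ∈ t) →
      funMap f x ∈ t := fun {n} f x hx => ht ⟨n, funMap f⟩ (Or.inr ⟨⟨n, f⟩, rfl⟩) x hx
  let N : Subgroup H :=
    { carrier := t
      one_mem' := hfun GroupFunc.one ![] (fun i => i.elim0)
      mul_mem' := fun {a b} ha hb => hfun GroupFunc.mul ![a, b] (by simp [Fin.forall_fin_two, ha, hb])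
      inv_mem' := fun {a} ha => hfun GroupFunc.inv ![a] (by simp [ha]) }
  refine ⟨N, hst, ?_, hcard⟩
  let SN := groupStructure N
  let SLN : L.Structure N :=
    { funMap := fun f x => ⟨funMap f fun i => (x i : H), hfun' f _ fun i => (x i).2⟩
      RelMap := fun r x => RelMap r fun i => (x i : H) }
  let j : N ↪[groupLanguage.sum L] H :=
    { toFun := Subtype.val
      inj' := Subtype.val_injective
      map_fun' := by
        rintro n (f | f) x
        · cases f <;> rfl
        · rfl
      map_rel' := by
        rintro n (r | r) x
        · cases r
        · exact Iff.rfl }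
  have hj : Set.range j = t := Subtype.range_coe
  obtain ⟨gN, hgN, hKN⟩ := (h N).2 ⟨SLN, fun φ hφ => by
    rw [hF' φ N j (by
      rw [hj]
      exact ht.mono fun f hf => Or.inl (Or.inl (Set.mem_biUnion hφ hf)))]
    convert hmod φ hφ using 1⟩
  have : gN = N.toGroup := groupStructure_injective hgN
  exact this ▸ hKN

end BountifulGroups

namespace BountifulGroups

/-! ### Groups with a sequence of unary predicates -/

/-- The symbols of a language with a sequence of unary predicates. -/
inductive UnaryPred : ℕ → Type
  | mk (k : ℕ) : UnaryPred 1

/-- The language with a sequence of unary predicates. -/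
def predLanguage : FirstOrder.Language.{0, 0} where
  Functions := fun _ => Empty
  Relations := UnaryPred

/-- A sequence of subsets, seen as a structure for the language of unary predicates. -/
@[reducible] def predStructure {M : Type u} (P : ℕ → Set M) : predLanguage.Structure M where
  funMap := fun f => nomatch f
  RelMap := fun {n} (r : UnaryPred n) =>
    match n, r with
    | _, .mk k => fun x => x 0 ∈ P k

/-- Lets an arbitrary expansion of a group be read as a sequence of subsets, as needed to pass from
models back to the class. -/
theorem exists_eq_predStructure {M : Type u} (S : predLanguage.Structure M) :
    ∃ P : ℕ → Set M, S = predStructure P := by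
  refine ⟨fun k => {x | S.RelMap (UnaryPred.mk k) ![x]}, ?_⟩
  ext n f x
  · cases f
  · cases f
    change _ ↔ S.RelMap _ ![x 0]
    rw [show x = ![x 0] by ext i; fin_cases i; rfl]
    rfl

instance : Countable predLanguage.Symbols := by
  have : Function.Injective (fun s : predLanguage.Symbols =>
      match s with
      | .inl f => nomatch f.2
      | .inr ⟨_, .mk k⟩ => k) := by
    rintro (⟨n, f⟩ | ⟨n, ⟨k⟩⟩) (⟨m, g⟩ | ⟨m, ⟨l⟩⟩) h
    · cases f
    · cases f
    · cases g
    · simp_all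
  exact this.countable

/-- The language of groups with a sequence of unary predicates. -/
abbrev groupPredLanguage : FirstOrder.Language.{0, 0} := groupLanguage.sum predLanguage

/-- A group with a sequence of subsets, seen as a first-order structure. -/
@[reducible] def groupPredStructure (M : Type u) [Group M] (P : ℕ → Set M) :
    groupPredLanguage.Structure M :=
  @Language.sumStructure groupLanguage predLanguage M (groupStructure M) (predStructure P)

/-- A property of `n`-tuples in groups with a sequence of subsets is definable if it is expressed
by a formula of `L_{ω₁ω}`. -/
def Definable {n : ℕ}
    (Φ : ∀ (M : Type u) [Group M], (ℕ → Set M) → (Fin n → M) → Prop) : Prop :=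
  ∃ φ : InfFormula groupPredLanguage n, ∀ (M : Type u) [Group M] (P : ℕ → Set M) (v : Fin n → M),
    @InfFormula.Realize _ M (groupPredStructure M P) n φ v ↔ Φ M P v

/-- An operation on groups is definable if it is expressed by a term. -/
def TermDefinable {n : ℕ} (τ : ∀ (M : Type u) [Group M], (Fin n → M) → M) : Prop :=
  ∃ t : groupPredLanguage.Term (Fin n), ∀ (M : Type u) [Group M] (P : ℕ → Set M) (v : Fin n → M),
    @Language.Term.realize _ M (groupPredStructure M P) _ v t = τ M v

/-- A property of elements in groups with a sequence of subsets is definable if it is expressed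
by a formula of `L_{ω₁ω}`, here in a form that allows for substitution of terms. -/
def PredDefinable (Q : ∀ (M : Type u) [Group M], (ℕ → Set M) → M → Prop) : Prop :=
  ∀ ⦃n : ℕ⦄ ⦃τ : ∀ (M : Type u) [Group M], (Fin n → M) → M⦄, TermDefinable τ →
    Definable fun M _ P v => Q M P (τ M v)

/-! ### Closure of definability under terms, connectives and quantifiers -/

namespace TermDefinable

variable {n : ℕ} {τ σ : ∀ (M : Type u) [Group M], (Fin n → M) → M}

theorem var (i : Fin n) : TermDefinable.{u} fun _ _ v => v i :=
  ⟨.var i, fun _ _ _ _ => rfl⟩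

theorem one : TermDefinable.{u} (n := n) fun _ _ _ => 1 :=
  ⟨.func (Sum.inl GroupFunc.one) ![], fun _ _ _ _ => rfl⟩

theorem inv (h : TermDefinable τ) : TermDefinable fun M _ v => (τ M v)⁻¹ := by
  obtain ⟨t, ht⟩ := h
  exact ⟨.func (Sum.inl GroupFunc.inv) ![t], fun M _ P v => congrArg (·⁻¹) (ht M P v)⟩

theorem mul (h : TermDefinable τ) (h' : TermDefinable σ) :
    TermDefinable fun M _ v => τ M v * σ M v := by
  obtain ⟨t, ht⟩ := h
  obtain ⟨s, hs⟩ := h'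
  exact ⟨.func (Sum.inl GroupFunc.mul) ![t, s], fun M _ P v =>
    congrArg₂ (· * ·) (ht M P v) (hs M P v)⟩

theorem weaken (h : TermDefinable τ) :
    TermDefinable (n := n + 1) fun M _ v => τ M fun i => v i.castSucc := by
  obtain ⟨t, ht⟩ := h
  refine ⟨t.relabel Fin.castSucc, fun M _ P v => ?_⟩
  let _ := groupPredStructure M P
  exact Language.Term.realize_relabel.trans (ht M P _)

end TermDefinable

namespace Definable

variable {n : ℕ} {Φ Ψ : ∀ (M : Type u) [Group M], (ℕ → Set M) → (Fin n → M) → Prop}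

theorem congr (h : Definable Φ)
    (h' : ∀ (M : Type u) [Group M] (P : ℕ → Set M) (v : Fin n → M), Φ M P v ↔ Ψ M P v) :
    Definable Ψ := by
  obtain ⟨φ, hφ⟩ := h
  exact ⟨φ, fun M _ P v => (hφ M P v).trans (h' M P v)⟩

theorem eq {τ σ : ∀ (M : Type u) [Group M], (Fin n → M) → M} (h : TermDefinable τ)
    (h' : TermDefinable σ) : Definable fun M _ _ v => τ M v = σ M v := by
  obtain ⟨t, ht⟩ := h
  obtain ⟨s, hs⟩ := h'
  exact ⟨.equal t s, fun M _ P v => by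
    beta_reduce
    rw [← ht M P, ← hs M P]
    rfl⟩

theorem mem {τ : ∀ (M : Type u) [Group M], (Fin n → M) → M} (k : ℕ) (h : TermDefinable τ) :
    Definable fun M _ P v => τ M v ∈ P k := by
  obtain ⟨t, ht⟩ := h
  exact ⟨.rel (Sum.inr (UnaryPred.mk k)) ![t], fun M _ P v => by
    beta_reduce
    rw [← ht M P]
    rfl⟩

theorem falsum : Definable.{u} (n := n) fun _ _ _ _ => False :=
  ⟨.falsum, fun _ _ _ _ => Iff.rfl⟩

theorem imp (h : Definable Φ) (h' : Definable Ψ) : Definable fun M _ P v => Φ M P v → Ψ M P v := by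
  obtain ⟨φ, hφ⟩ := h
  obtain ⟨ψ, hψ⟩ := h'
  exact ⟨.imp φ ψ, fun M _ P v => imp_congr (hφ M P v) (hψ M P v)⟩

theorem not (h : Definable Φ) : Definable fun M _ P v => ¬ Φ M P v :=
  h.imp falsum

theorem or (h : Definable Φ) (h' : Definable Ψ) : Definable fun M _ P v => Φ M P v ∨ Ψ M P v :=
  (h.not.imp h').congr fun _ _ _ _ => or_iff_not_imp_left.symm

theorem and (h : Definable Φ) (h' : Definable Ψ) : Definable fun M _ P v => Φ M P v ∧ Ψ M P v :=
  (h.imp h'.not).not.congr fun _ _ _ _ => by tauto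

theorem all {Φ : ∀ (M : Type u) [Group M], (ℕ → Set M) → (Fin n → M) → M → Prop}
    (h : Definable (n := n + 1) fun M _ P v => Φ M P (fun i => v i.castSucc) (v (Fin.last n))) :
    Definable fun M _ P v => ∀ x, Φ M P v x := by
  obtain ⟨φ, hφ⟩ := h
  refine ⟨.all φ, fun M _ P v => ?_⟩
  simp only [InfFormula.Realize, hφ, Fin.snoc_castSucc, Fin.snoc_last]

theorem ex {Φ : ∀ (M : Type u) [Group M], (ℕ → Set M) → (Fin n → M) → M → Prop}
    (h : Definable (n := n + 1) fun M _ P v => Φ M P (fun i => v i.castSucc) (v (Fin.last n))) :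
    Definable fun M _ P v => ∃ x, Φ M P v x :=
  (all (Φ := fun M _ P v x => ¬ Φ M P v x) h.not).not.congr fun _ _ _ _ => by simp

theorem iInf {ι : Type} [Countable ι]
    {Φ : ι → ∀ (M : Type u) [Group M], (ℕ → Set M) → (Fin n → M) → Prop}
    (h : ∀ i, Definable (Φ i)) : Definable fun M _ P v => ∀ i, Φ i M P v := by
  choose φ hφ using h
  obtain hι | hι := isEmpty_or_nonempty ι
  · exact falsum.not.congr fun _ _ _ _ => by simp
  · obtain ⟨e, he⟩ := exists_surjective_nat ι
    refine ⟨.conj fun k => φ (e k), fun M _ P v => ?_⟩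
    simp only [InfFormula.Realize, hφ]
    exact ⟨fun h i => (he i).elim fun k hk => hk ▸ h k, fun h k => h _⟩

theorem iSup {ι : Type} [Countable ι]
    {Φ : ι → ∀ (M : Type u) [Group M], (ℕ → Set M) → (Fin n → M) → Prop}
    (h : ∀ i, Definable (Φ i)) : Definable fun M _ P v => ∃ i, Φ i M P v :=
  (iInf fun i => (h i).not).not.congr fun _ _ _ _ => by simp

/-- For side conditions that concern only the indices, such as `n = m` or `l ≠ []`, and not the
group. -/
theorem const (p : Prop) : Definable.{u} (n := n) fun _ _ _ _ => p := by
  by_cases h : p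
  · exact falsum.not.congr fun _ _ _ _ => by simp [h]
  · exact falsum.congr fun _ _ _ _ => by simp [h]

end Definable

open Language in
/-- The sentences that express the group axioms. -/
def groupAxioms : Set (InfSentence groupPredLanguage) :=
  let mul (n : ℕ) (t s : groupPredLanguage.Term (Fin n)) : groupPredLanguage.Term (Fin n) :=
    .func (Sum.inl GroupFunc.mul) ![t, s]
  {.all (.all (.all (.equal (mul 3 (mul 3 (.var 0) (.var 1)) (.var 2))
      (mul 3 (.var 0) (mul 3 (.var 1) (.var 2)))))),
    .all (.equal (mul 1 (.func (Sum.inl GroupFunc.one) ![]) (.var 0)) (.var 0)),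
    .all (.equal (mul 1 (.func (Sum.inl GroupFunc.inv) ![.var 0]) (.var 0))
      (.func (Sum.inl GroupFunc.one) ![]))}

open Language Structure in
theorem isModel_groupAxioms_iff (M : Type u) [S : groupLanguage.Structure M]
    [predLanguage.Structure M] :
    IsModel M groupAxioms ↔ ∃ _ : Group M, groupStructure M = S := by
  let mul (x y : M) : M := funMap (L := groupLanguage) GroupFunc.mul ![x, y]
  let one : M := funMap (L := groupLanguage) GroupFunc.one ![]
  let inv (x : M) : M := funMap (L := groupLanguage) GroupFunc.inv ![x]
  have key : IsModel M groupAxioms ↔ (∀ x y z, mul (mul x y) z = mul x (mul y z)) ∧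
      (∀ x, mul one x = x) ∧ ∀ x, mul (inv x) x = one := by
    have hmul : ∀ {n : ℕ} (v : Fin n → M) (t s : groupPredLanguage.Term (Fin n)),
        Term.realize v (.func (Sum.inl GroupFunc.mul) ![t, s] : groupPredLanguage.Term (Fin n)) =
          mul (t.realize v) (s.realize v) := fun v t s =>
      congrArg (funMap (L := groupLanguage) GroupFunc.mul) (by ext i; fin_cases i <;> rfl)
    have hinv : ∀ {n : ℕ} (v : Fin n → M) (t : groupPredLanguage.Term (Fin n)),
        Term.realize v (.func (Sum.inl GroupFunc.inv) ![t] : groupPredLanguage.Term (Fin n)) =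
          inv (t.realize v) := fun v t =>
      congrArg (funMap (L := groupLanguage) GroupFunc.inv) (by ext i; fin_cases i; rfl)
    have hone : ∀ {n : ℕ} (v : Fin n → M),
        Term.realize v (.func (Sum.inl GroupFunc.one) ![] : groupPredLanguage.Term (Fin n)) =
          one := fun v =>
      congrArg (funMap (L := groupLanguage) GroupFunc.one) (Subsingleton.elim _ _)
    simp only [IsModel, groupAxioms, Set.mem_insert_iff, Set.mem_singleton_iff, forall_eq_or_imp,
      forall_eq, InfFormula.Realize, hmul, hinv, hone, Term.realize_var]
    exact Iff.rfl
  rw [key]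
  constructor
  · rintro ⟨h₁, h₂, h₃⟩
    let _ : Mul M := ⟨mul⟩
    let _ : One M := ⟨one⟩
    let _ : Inv M := ⟨inv⟩
    refine ⟨Group.ofLeftAxioms h₁ h₂ h₃, ?_⟩
    ext n f x
    · cases f
      · change S.funMap _ ![] = _
        rw [Subsingleton.elim x ![] ]
      · change S.funMap _ ![x 0] = _
        rw [← show x = ![x 0] by ext i; fin_cases i; rfl]
      · change S.funMap _ ![x 0, x 1] = _
        rw [← show x = ![x 0, x 1] by ext i; fin_cases i <;> rfl]
    · nomatch f
  · rintro ⟨_, rfl⟩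
    exact ⟨mul_assoc, one_mul, inv_mul_cancel⟩

/-- The existential quantifier over `P` is absorbed by the choice of an expansion: the new
predicates interpret `P`. -/
theorem Definable.isReductOfAxiomatizable {K : GroupClass.{u}}
    {Φ : ∀ (M : Type u) [Group M], (ℕ → Set M) → Prop}
    (h : Definable (n := 0) fun M _ P _ => Φ M P)
    (hK : ∀ (M : Type u) [Group M], K M ↔ ∃ P, Φ M P) : IsReductOfAxiomatizable K := by
  obtain ⟨φ, hφ⟩ := h
  refine ⟨predLanguage, insert φ groupAxioms, inferInstance, ?_, fun M S => ?_⟩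
  · exact Set.Countable.insert _ (Set.Finite.countable (by simp [groupAxioms]))
  have key : ∀ SP : predLanguage.Structure M, IsModel M (insert φ groupAxioms) ↔
      φ.Realize M Fin.elim0 ∧ ∃ _ : Group M, groupStructure M = S := by
    intro SP
    rw [← isModel_groupAxioms_iff]
    simp [IsModel]
  constructor
  · rintro ⟨gM, rfl, hM⟩
    obtain ⟨P, hP⟩ := (hK M).1 hM
    refine ⟨predStructure P, ?_⟩
    rw [key]
    exact ⟨(hφ M P _).2 hP, gM, rfl⟩
  · rintro ⟨SP, hSP⟩
    rw [key] at hSP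
    obtain ⟨h, gM, rfl⟩ := hSP
    obtain ⟨P, rfl⟩ := exists_eq_predStructure SP
    exact ⟨gM, rfl, (hK M).2 ⟨P, (hφ M P _).1 h⟩⟩

end BountifulGroups

namespace BountifulGroups

/-! ### Groups without property FA -/

/-- The action of `N` on an invariant induced subgraph. -/
def inducedAction {H : Type u} [Group H] {X : Type u} {T : SimpleGraph X} (ρ : H →* (T ≃g T))
    (N : Subgroup H) (Y : Set X) (hY : ∀ g ∈ N, ∀ x ∈ Y, ρ g x ∈ Y) :
    N →* (T.induce Y ≃g T.induce Y) where
  toFun g :=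
    { toFun := fun x => ⟨ρ g x, hY g g.2 x x.2⟩
      invFun := fun x => ⟨ρ (g⁻¹ : N) x, hY _ (g⁻¹ : N).2 x x.2⟩
      left_inv := fun x => Subtype.ext (by simp)
      right_inv := fun x => Subtype.ext (by simp)
      map_rel_iff' := fun {x y} => (ρ g).map_rel_iff }
  map_one' := by ext x; simp
  map_mul' g h := by ext x; simp

/-- Choose for each vertex an element moving it and for each edge an element not preserving it.
Close `G` and one vertex under these choices, the group operations, the action, and the vertices of
chosen walks. The vertices obtained span a subtree on which the group elements obtained act without
a fixed point. -/
theorem bountiful_not_propertyFA : Bountiful.{u} fun G _ => ¬ PropertyFA G := by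
  intro H _ G hG hH
  simp only [PropertyFA, not_forall, not_or, not_exists, not_and] at hH
  obtain ⟨X, T, hT, ρ, hv, he⟩ := hH
  choose m hm using hv
  -- The witness is made total in `x` and `y`; for non-adjacent pairs `1` is a dummy value.
  have he' : ∀ x y : X, ∃ g, T.Adj x y → s(x, y).map (ρ g) ≠ s(x, y) := by
    intro x y
    by_cases h : T.Adj x y
    · obtain ⟨g, hg⟩ := he s(x, y) h
      exact ⟨g, fun _ => hg⟩
    · exact ⟨1, fun h' => absurd h' h⟩
  choose e he using he'
  have p := fun x y => (hT.connected x y).some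
  obtain ⟨x₀⟩ := hT.connected.nonempty
  let op₁ (f : H ⊕ X → H ⊕ X) : Σ k, (Fin k → H ⊕ X) → H ⊕ X := ⟨1, fun x => f (x 0)⟩
  let op₂ (f : H ⊕ X → H ⊕ X → H ⊕ X) : Σ k, (Fin k → H ⊕ X) → H ⊕ X :=
    ⟨2, fun x => f (x 0) (x 1)⟩
  -- One binary operation packs the product, the action and the edge witness; the remaining case
  -- returns its first argument and adds nothing.
  let mul : H ⊕ X → H ⊕ X → H ⊕ X
    | .inl g, .inl h => .inl (g * h)
    | .inl g, .inr x => .inr (ρ g x)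
    | .inr x, .inr y => .inl (e x y)
    | a, _ => a
  -- Inverses together with the vertex witnesses.
  let inv : H ⊕ X → H ⊕ X
    | .inl g => .inl g⁻¹
    | .inr x => .inl (m x)
  -- Past the end of the walk, `getVert` stays at the endpoint, so all `k` are allowed.
  let path (k : ℕ) : H ⊕ X → H ⊕ X → H ⊕ X
    | .inr x, .inr y => .inr ((p x y).getVert k)
    | a, _ => a
  obtain ⟨t, hst, ht, hcard⟩ := exists_closedUnderOps
    (F := insert (op₂ mul) (insert (op₁ inv) (Set.range fun k => op₂ (path k))))
    (((Set.countable_range _).insert _).insert _) (insert (.inr x₀) (Sum.inl '' (G : Set H)))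
    (Set.Infinite.to_subtype (((Set.infinite_coe_iff.1 hG).image Sum.inl_injective.injOn).mono
      (Set.subset_insert _ _)))
  have hmul : ∀ a ∈ t, ∀ b ∈ t, mul a b ∈ t := fun a ha b hb =>
    ht (op₂ mul) (Or.inl rfl) ![a, b] (by simp [op₂, Fin.forall_fin_two, ha, hb])
  have hinv : ∀ a ∈ t, inv a ∈ t := fun a ha =>
    ht (op₁ inv) (Or.inr (Or.inl rfl)) ![a] (by simp [op₁, ha])
  have hpath : ∀ k, ∀ a ∈ t, ∀ b ∈ t, path k a b ∈ t := fun k a ha b hb =>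
    ht (op₂ (path k)) (Or.inr (Or.inr ⟨k, rfl⟩)) ![a, b] (by simp [op₂, Fin.forall_fin_two, ha, hb])
  have hGt : ∀ g ∈ G, Sum.inl g ∈ t := fun g hg => hst (Or.inr ⟨g, hg, rfl⟩)
  let N : Subgroup H :=
    { carrier := {g | Sum.inl g ∈ t}
      one_mem' := hGt 1 G.one_mem
      mul_mem' := fun ha hb => hmul _ ha _ hb
      inv_mem' := fun ha => hinv _ ha }
  let Y : Set X := {x | Sum.inr x ∈ t}
  refine ⟨N, hGt, fun hFA => ?_, ?_⟩
  · have hY : ∀ g ∈ N, ∀ x ∈ Y, ρ g x ∈ Y := fun g hg x hx => hmul _ hg _ hx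
    have hconn : (T.induce Y).IsTree := by
      -- Acyclicity is inherited by induced subgraphs; connectedness holds because the chosen walks
      -- stay in `Y`, and `x₀` makes `Y` nonempty.
      refine ⟨(SimpleGraph.connected_iff _).2 ⟨fun x y => ?_, ⟨x₀, hst (Or.inl rfl)⟩⟩,
        hT.isAcyclic.induce Y⟩
      refine ⟨(p x y).induce Y fun z hz => ?_⟩
      obtain ⟨k, rfl, _⟩ := SimpleGraph.Walk.mem_support_iff_exists_getVert.1 hz
      exact hpath k _ x.2 _ y.2
    obtain ⟨x, hx⟩ | ⟨d, hd, hd'⟩ := hFA Y (T.induce Y) hconn (inducedAction ρ N Y hY)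
    · exact hm x (congrArg Subtype.val (hx ⟨m x, hinv _ x.2⟩))
    · induction d with | _ x y =>
      refine he x y hd ?_
      have := congrArg (Sym2.map Subtype.val) (hd' ⟨e x y, hmul _ x.2 _ y.2⟩)
      exact this
  · apply le_antisymm
    · have h1 : #N ≤ #t := Cardinal.mk_le_of_injective (f := fun g : N => (⟨Sum.inl g, g.2⟩ : t))
        fun a b h => Subtype.ext (Sum.inl_injective (congrArg Subtype.val h))
      refine h1.trans (hcard.le.trans ?_)
      refine (Cardinal.mk_insert_le).trans ?_
      rw [Cardinal.mk_image_eq Sum.inl_injective]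
      exact (Cardinal.add_one_eq (Cardinal.infinite_iff.1 hG)).le
    · exact Cardinal.mk_le_mk_of_subset (s := (G : Set H)) (t := (N : Set H)) hGt

end BountifulGroups

namespace BountifulGroups

/-! ### Subgroups and words -/

/-- The set `S` is the carrier of a subgroup. -/
def IsSubgroupSet {M : Type u} [Group M] (S : Set M) : Prop :=
  1 ∈ S ∧ (∀ x, ∀ y, x ∈ S → y ∈ S → x * y ∈ S) ∧ ∀ x, x ∈ S → x⁻¹ ∈ S

theorem isSubgroupSet_iff {M : Type u} [Group M] {S : Set M} :
    IsSubgroupSet S ↔ ∃ H : Subgroup M, (H : Set M) = S := by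
  constructor
  · rintro ⟨h₁, h₂, h₃⟩
    exact ⟨{ carrier := S, one_mem' := h₁, mul_mem' := h₂ _ _, inv_mem' := h₃ _ }, rfl⟩
  · rintro ⟨H, rfl⟩
    exact ⟨H.one_mem, fun _ _ => H.mul_mem, fun _ => H.inv_mem⟩

/-- The element `x` is a product of `n` elements of `S ∪ S⁻¹ ∪ {1}`. -/
def IsWordIn {M : Type u} [Group M] (S : Set M) : ℕ → M → Prop
  | 0, x => x = 1
  | n + 1, x => ∃ y, (y ∈ S ∨ y⁻¹ ∈ S ∨ y = 1) ∧ ∃ z, IsWordIn S n z ∧ x = y * z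

theorem isWordIn_iff {M : Type u} [Group M] {S : Set M} {n : ℕ} {x : M} :
    IsWordIn S n x ↔ ∃ l : List M,
      l.length = n ∧ (∀ y ∈ l, y ∈ S ∨ y⁻¹ ∈ S ∨ y = 1) ∧ l.prod = x := by
  induction n generalizing x with
  | zero => simp [IsWordIn, eq_comm]
  | succ n ih =>
    constructor
    · rintro ⟨y, hy, z, hz, rfl⟩
      obtain ⟨l, hl, hl', rfl⟩ := ih.1 hz
      exact ⟨y :: l, by simp [hl], by simpa [hy] using hl', by simp⟩
    · rintro ⟨l, hl, hl', rfl⟩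
      cases l with
      | nil => simp at hl
      | cons y l =>
        simp only [List.length_cons, Nat.add_right_cancel_iff, List.mem_cons,
          forall_eq_or_imp] at hl hl'
        exact ⟨y, hl'.1, l.prod, ih.2 ⟨l, hl, hl'.2, rfl⟩, by simp⟩

/-- Turns generation, a statement about subgroups, into a countable disjunction over word lengths.
-/
theorem mem_closure_iff_isWordIn {M : Type u} [Group M] {S : Set M} {x : M} :
    x ∈ Subgroup.closure S ↔ ∃ n, IsWordIn S n x := by
  constructor
  · intro h
    rw [← Subgroup.mem_toSubmonoid, Subgroup.closure_toSubmonoid] at h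
    obtain ⟨l, hl, hl'⟩ := Submonoid.exists_list_of_mem_closure h
    refine ⟨l.length, isWordIn_iff.2 ⟨l, rfl, fun y hy => ?_, hl'⟩⟩
    exact (hl y hy).imp id Or.inl
  · rintro ⟨n, h⟩
    induction n generalizing x with
    | zero => exact (show x = 1 from h) ▸ one_mem _
    | succ n ih =>
      obtain ⟨y, hy, z, hz, rfl⟩ := h
      refine mul_mem ?_ (ih hz)
      obtain hy | hy | rfl := hy
      · exact Subgroup.subset_closure hy
      · exact inv_mem_iff.1 (Subgroup.subset_closure hy)
      · exact one_mem _

theorem closure_eq_top_iff_isWordIn {M : Type u} [Group M] {S : Set M} :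
    Subgroup.closure S = ⊤ ↔ ∀ x, ∃ n, IsWordIn S n x := by
  simp only [Subgroup.eq_top_iff', mem_closure_iff_isWordIn]

theorem Definable.isSubgroupSet {n : ℕ} (k : ℕ) :
    Definable.{u} (n := n) fun _ _ P _ => IsSubgroupSet (P k) :=
  .and (.mem k .one) (.and
    (.all (.all (.imp (.mem k (.var _)) (.imp (.mem k (.var _)) (.mem k (.mul (.var _) (.var _)))))))
    (.all (.imp (.mem k (.var _)) (.mem k (.inv (.var _))))))

theorem PredDefinable.mem (k : ℕ) : PredDefinable.{u} fun _ _ P x => x ∈ P k :=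
  fun _ _ h => .mem k h

theorem PredDefinable.isWordIn {S : ∀ (M : Type u) [Group M], (ℕ → Set M) → Set M}
    (h : PredDefinable fun M _ P x => x ∈ S M P) (n : ℕ) :
    PredDefinable fun M _ P x => IsWordIn (S M P) n x := by
  induction n with
  | zero => exact fun m τ hτ => .eq hτ .one
  | succ n ih =>
    intro m τ hτ
    refine .ex (.and (.or (h (.var _)) (.or (h (.inv (.var _))) (.eq (.var _) .one))) ?_)
    exact .ex (.and (ih (.var _)) (.eq hτ.weaken.weaken (.mul (.var _) (.var _))))

theorem Definable.closure_eq_top {n : ℕ} {S : ∀ (M : Type u) [Group M], (ℕ → Set M) → Set M}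
    (h : PredDefinable fun M _ P x => x ∈ S M P) :
    Definable (n := n) fun M _ P _ => Subgroup.closure (S M P) = ⊤ :=
  (Definable.all (.iSup fun k => h.isWordIn k (.var _))).congr
    fun _ _ _ _ => closure_eq_top_iff_isWordIn.symm

/-! ### Cofinality, Cayley boundedness and maps onto `ℤ` -/

theorem cofinalityLeOmega_iff (M : Type u) [Group M] :
    CofinalityLeOmega M ↔ ∃ P : ℕ → Set M, (∀ k, IsSubgroupSet (P k) ∧
      (∀ x, x ∈ P k → x ∈ P (k + 1)) ∧ (∃ x, x ∈ P (k + 1) ∧ ¬ x ∈ P k) ∧ ∃ x, ¬ x ∈ P k) ∧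
      ∀ x, ∃ k, x ∈ P k := by
  constructor
  · rintro ⟨H, hH, hH', h⟩
    refine ⟨fun k => H k, fun k => ⟨isSubgroupSet_iff.2 ⟨_, rfl⟩, ?_, ?_, ?_⟩, h⟩
    · exact hH.monotone k.le_succ
    · exact SetLike.exists_of_lt (hH k.lt_succ_self)
    · by_contra hc
      push Not at hc
      exact hH' k ((Subgroup.eq_top_iff' _).2 hc)
  · rintro ⟨P, hP, h⟩
    choose H hH using fun k => isSubgroupSet_iff.1 (hP k).1
    simp only [← hH, SetLike.mem_coe] at hP h
    refine ⟨H, strictMono_nat_of_lt_succ fun k => ?_, fun k hk => ?_, h⟩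
    · obtain ⟨x, hx, hx'⟩ := (hP k).2.2.1
      exact lt_of_le_of_ne (hP k).2.1 fun he => hx' (he ▸ hx)
    · obtain ⟨x, hx⟩ := (hP k).2.2.2
      exact hx (hk ▸ Subgroup.mem_top x)

theorem definable_cofinality : Definable.{u} (n := 0) fun _ _ P _ =>
    (∀ k, IsSubgroupSet (P k) ∧
      (∀ x, x ∈ P k → x ∈ P (k + 1)) ∧ (∃ x, x ∈ P (k + 1) ∧ ¬ x ∈ P k) ∧ ∃ x, ¬ x ∈ P k) ∧
      ∀ x, ∃ k, x ∈ P k :=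
  .and (.iInf fun k => .and (.isSubgroupSet k) (.and
      (.all (.imp (.mem _ (.var _)) (.mem _ (.var _))))
      (.and (.ex (.and (.mem _ (.var _)) (.not (.mem _ (.var _)))))
        (.ex (.not (.mem _ (.var _)))))))
    (.all (.iSup fun _ => .mem _ (.var _)))

theorem isReductOfAxiomatizable_cofinality :
    IsReductOfAxiomatizable.{u} fun G _ => CofinalityLeOmega G :=
  definable_cofinality.isReductOfAxiomatizable fun M _ => cofinalityLeOmega_iff M

theorem not_cayleyBounded_iff (M : Type u) [Group M] :
    ¬ CayleyBounded M ↔ ∃ P : ℕ → Set M, Subgroup.closure (P 0) = ⊤ ∧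
      ∀ n, ∃ x, ¬ IsWordIn (P 0) n x := by
  simp only [CayleyBounded, isWordIn_iff, not_forall, not_exists, exists_prop]
  exact ⟨fun ⟨U, hU⟩ => ⟨fun _ => U, hU⟩, fun ⟨P, hP⟩ => ⟨P 0, hP⟩⟩

theorem definable_not_cayleyBounded : Definable.{u} (n := 0) fun _ _ P _ =>
    Subgroup.closure (P 0) = ⊤ ∧ ∀ n, ∃ x, ¬ IsWordIn (P 0) n x :=
  .and (.closure_eq_top (.mem 0))
    (.iInf fun n => .ex (.not ((PredDefinable.mem 0).isWordIn n (.var _))))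

theorem isReductOfAxiomatizable_not_cayleyBounded :
    IsReductOfAxiomatizable.{u} fun G _ => ¬ CayleyBounded G :=
  definable_not_cayleyBounded.isReductOfAxiomatizable fun M _ => not_cayleyBounded_iff M

/-- The existential over `P` distributes over the disjunction, so the same predicates serve both
alternatives. -/
theorem isReductOfAxiomatizable_not_stronglyBounded :
    IsReductOfAxiomatizable.{u} fun G _ => ¬ StronglyBounded G :=
  (definable_not_cayleyBounded.or definable_cofinality).isReductOfAxiomatizable fun M _ => by
    rw [exists_or, ← not_cayleyBounded_iff, ← cofinalityLeOmega_iff, StronglyBounded, not_and_or,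
      not_not]

/-- The predicates are the fibres of the map, indexed through an encoding of `ℤ` in `ℕ`. A nonempty
fibre over `1` suffices for surjectivity, by taking powers. -/
theorem mapsOntoInt_iff (M : Type u) [Group M] :
    MapsOntoInt M ↔ ∃ P : ℕ → Set M, (∀ x, ∃ n : ℤ, x ∈ P (Encodable.encode n)) ∧
      (∀ n m : ℤ, ∀ x, x ∈ P (Encodable.encode n) → x ∈ P (Encodable.encode m) → n = m) ∧
      (∀ n m : ℤ, ∀ x, ∀ y, x ∈ P (Encodable.encode n) → y ∈ P (Encodable.encode m) →
        x * y ∈ P (Encodable.encode (n + m))) ∧ ∃ x, x ∈ P (Encodable.encode (1 : ℤ)) := by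
  constructor
  · rintro ⟨f, hf⟩
    refine ⟨fun k => {x | Encodable.encode (f x).toAdd = k}, fun x => ⟨(f x).toAdd, rfl⟩, ?_, ?_, ?_⟩
    · intro n m x hn hm
      exact Encodable.encode_injective (hn.symm.trans hm)
    · intro n m x y hx hy
      simp only [Set.mem_ofPred_eq, Encodable.encode_inj, map_mul, toAdd_mul] at hx hy ⊢
      rw [hx, hy]
    · obtain ⟨x, hx⟩ := hf (Multiplicative.ofAdd 1)
      exact ⟨x, by simp [hx]⟩
  · rintro ⟨P, h₁, h₂, h₃, x₁, hx₁⟩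
    choose f hf using h₁
    let F : M →* Multiplicative ℤ := MonoidHom.mk' (fun x => Multiplicative.ofAdd (f x)) fun x y =>
      congrArg Multiplicative.ofAdd (h₂ _ _ _ (hf _) (h₃ _ _ _ _ (hf x) (hf y)))
    refine ⟨F, fun n => ⟨x₁ ^ n.toAdd, ?_⟩⟩
    have h1 : F x₁ = Multiplicative.ofAdd 1 :=
      congrArg Multiplicative.ofAdd (h₂ _ _ _ (hf _) hx₁)
    rw [map_zpow, h1, ← ofAdd_zsmul]
    simp

theorem isReductOfAxiomatizable_mapsOntoInt :
    IsReductOfAxiomatizable.{u} fun G _ => MapsOntoInt G := by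
  refine Definable.isReductOfAxiomatizable ?_ fun M _ => mapsOntoInt_iff M
  refine .and (.all (.iSup fun _ => .mem _ (.var _))) (.and ?_ (.and ?_ (.ex (.mem _ (.var _)))))
  · exact .iInf fun n => .iInf fun m => .all (.imp (.mem _ (.var _))
      (.imp (.mem _ (.var _)) (.const _)))
  · exact .iInf fun n => .iInf fun m => .all (.all (.imp (.mem _ (.var _))
      (.imp (.mem _ (.var _)) (.mem _ (.mul (.var _) (.var _))))))

end BountifulGroups

namespace BountifulGroups

/-! ### Free products with amalgamation -/

/-- The element `x` is a product of factors outside the intersection of `A 0` and `A 1`, and the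
list `l` tells for each factor in which of the two sets it lies. -/
def IsAmalgamWord {M : Type u} [Group M] (A : Fin 2 → Set M) : List (Fin 2) → M → Prop
  | [], x => x = 1
  | i :: l, x => ∃ y, (y ∈ A i ∧ ¬ (y ∈ A 0 ∧ y ∈ A 1)) ∧ ∃ z, IsAmalgamWord A l z ∧ x = y * z

open Monoid

theorem isAmalgamWord_prod {M : Type u} [Group M] (A : Fin 2 → Subgroup M)
    (l : List (Σ i, A i)) (hl : ∀ p ∈ l, (p.2 : M) ∉ A 0 ⊓ A 1) :
    IsAmalgamWord (fun i => (A i : Set M)) (l.map Sigma.fst)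
      (l.map fun p => (p.2 : M)).prod := by
  induction l with
  | nil => rfl
  | cons p l ih =>
    simp only [List.mem_cons, forall_eq_or_imp] at hl
    exact ⟨p.2, ⟨p.2.2, hl.1⟩, _, ih hl.2, by simp⟩

/-- A normal word is reduced: a letter in the image of `H` would be the transversal's representative
of the trivial coset, hence `1`. -/
theorem PushoutI.exists_prod_eq {ι : Type*} {G : ι → Type*} {H : Type*} [∀ i, Group (G i)]
    [Group H] {φ : ∀ i, H →* G i} (hφ : ∀ i, Function.Injective (φ i)) (x : PushoutI φ) :
    ∃ (h : H) (w : CoprodI.Word G), PushoutI.Reduced φ w ∧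
      x = PushoutI.base φ h * PushoutI.ofCoprodI w.prod := by
  classical
  obtain ⟨d⟩ := PushoutI.NormalWord.transversal_nonempty φ hφ
  obtain ⟨nw, rfl⟩ := (PushoutI.NormalWord.equiv (d := d)).symm.surjective x
  refine ⟨nw.head, nw.toWord, ?_, rfl⟩
  rintro ⟨i, g⟩ hg hr
  refine nw.ne_one _ hg ?_
  -- Compare the factorizations `g * 1` and `1 * g` of the same element.
  have := @(d.compl i).1 (⟨g, hr⟩, ⟨1, d.one_mem i⟩) (1, ⟨g, nw.normalized i g hg⟩) (by simp)
  exact congrArg Subtype.val (congrArg Prod.snd this).symm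

/-- Forwards, this is the normal form theorem: a reduced word with value in the base is empty.
Backwards, the pushout over `A 0 ⊓ A 1` maps onto `M` by generation. A kernel element is a base
element times a reduced word, whose product then lies in `A 0 ⊓ A 1`, so the word is empty. Only the
pattern `l` is quantified outside the group, and it ranges over a countable set. -/
theorem isNontrivialAmalgam_iff (M : Type u) [Group M] :
    IsNontrivialAmalgam M ↔ ∃ A : Fin 2 → Subgroup M, (∃ x ∈ A 0, x ∉ A 1) ∧
      (∃ x ∈ A 1, x ∉ A 0) ∧ Subgroup.closure ((A 0 : Set M) ∪ A 1) = ⊤ ∧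
      ∀ l : List (Fin 2), l.IsChain (· ≠ ·) → l ≠ [] → ∀ x ∈ A 0, x ∈ A 1 →
        ¬ IsAmalgamWord (fun i => (A i : Set M)) l x := by
  constructor
  · rintro ⟨A, C, _, _, φ, hφ, hφ', ⟨e⟩⟩
    let B (i : Fin 2) : Subgroup M := ((e.symm : PushoutI φ →* M).comp (PushoutI.of i)).range
    have hB : ∀ i x, x ∈ B i ↔ e x ∈ (PushoutI.of (φ := φ) i).range := by
      intro i x
      simp [B, MonoidHom.mem_range, e.symm_apply_eq]
    have hC : ∀ x, x ∈ B 0 ∧ x ∈ B 1 ↔ e x ∈ (PushoutI.base φ).range := by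
      intro x
      rw [hB, hB, ← PushoutI.inf_of_range_eq_base_range hφ (show (0 : Fin 2) ≠ 1 by decide),
        Subgroup.mem_inf]
    have hof : ∀ i (y : A i), y ∈ (φ i).range ↔
        PushoutI.of i y ∈ (PushoutI.base φ).range := by
      intro i y
      constructor
      · rintro ⟨c, rfl⟩
        exact ⟨c, (PushoutI.of_apply_eq_base φ i c).symm⟩
      · rintro ⟨c, hc⟩
        rw [← PushoutI.of_apply_eq_base φ i] at hc
        exact ⟨c, PushoutI.of_injective hφ i hc⟩
    have hne : ∀ i, ∃ x ∈ B i, ¬ (x ∈ B 0 ∧ x ∈ B 1) := by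
      intro i
      obtain ⟨y, hy⟩ := not_forall.1 (hφ' i)
      refine ⟨e.symm (PushoutI.of i y), ⟨y, rfl⟩, ?_⟩
      rw [hC, e.apply_symm_apply, ← hof]
      exact hy
    refine ⟨B, ?_, ?_, ?_, ?_⟩
    · obtain ⟨x, hx, hx'⟩ := hne 0
      exact ⟨x, hx, fun h => hx' ⟨hx, h⟩⟩
    · obtain ⟨x, hx, hx'⟩ := hne 1
      exact ⟨x, hx, fun h => hx' ⟨h, hx⟩⟩
    · rw [Subgroup.eq_top_iff']
      intro x
      obtain ⟨x, rfl⟩ := e.symm.surjective x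
      have hmem : ∀ i (g : A i),
          e.symm (PushoutI.of i g) ∈ Subgroup.closure ((B 0 : Set M) ∪ B 1) := by
        intro i g
        refine Subgroup.subset_closure ?_
        have : e.symm (PushoutI.of i g) ∈ B i := ⟨g, rfl⟩
        fin_cases i
        · exact Or.inl this
        · exact Or.inr this
      induction x using PushoutI.induction_on with
      | of i g => exact hmem i g
      | base h => exact PushoutI.of_apply_eq_base φ 0 h ▸ hmem 0 _
      | mul x y hx hy => exact map_mul e.symm x y ▸ mul_mem hx hy
    · intro l hl hne x hx hx' hw
      -- Lifts a word in `M` letter by letter to a word in the abstract factors with no letter from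
      -- the amalgamated subgroup.
      have key : ∀ (l : List (Fin 2)) (x : M), IsAmalgamWord (fun i => (B i : Set M)) l x →
          ∃ w : List (Σ i, A i), w.map Sigma.fst = l ∧ (∀ p ∈ w, p.2 ∉ (φ p.1).range) ∧
            e x = (w.map fun p => PushoutI.of p.1 p.2).prod := by
        intro l
        induction l with
        | nil =>
          intro x hx
          exact ⟨[], rfl, by simp, by simp [show x = 1 from hx]⟩
        | cons i l ih =>
          rintro x ⟨y, ⟨hy, hy'⟩, z, hz, rfl⟩
          obtain ⟨w, rfl, hw, hw'⟩ := ih z hz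
          obtain ⟨a, ha⟩ := (hB i y).1 hy
          refine ⟨⟨i, a⟩ :: w, rfl, ?_, ?_⟩
          · simp only [List.mem_cons, forall_eq_or_imp]
            refine ⟨?_, hw⟩
            rw [hof, ha, ← hC]
            exact hy'
          · simp [ha, hw']
      obtain ⟨w, rfl, hw, hw'⟩ := key l x hw
      let W : CoprodI.Word A := ⟨w, fun p hp h1 => hw p hp (h1 ▸ one_mem _),
        (List.isChain_map Sigma.fst).1 hl⟩
      have : W = .empty := by
        refine PushoutI.Reduced.eq_empty_of_mem_range (w := W) hφ hw ?_
        have : PushoutI.ofCoprodI W.prod = e x := by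
          rw [hw', CoprodI.Word.prod, map_list_prod, List.map_map]
          rfl
        rw [this, ← hC]
        exact ⟨hx, hx'⟩
      exact hne (by rw [show w = [] from congrArg CoprodI.Word.toList this]; rfl)
  · rintro ⟨A, ⟨x₀, hx₀, hx₀'⟩, ⟨x₁, hx₁, hx₁'⟩, htop, hred⟩
    have hle : ∀ i, A 0 ⊓ A 1 ≤ A i := by
      intro i
      fin_cases i
      · exact inf_le_left
      · exact inf_le_right
    let φ (i : Fin 2) : (A 0 ⊓ A 1 : Subgroup M) →* A i := Subgroup.inclusion (hle i)
    have hφ : ∀ i, Function.Injective (φ i) := fun i => Subgroup.inclusion_injective (hle i)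
    have hrange : ∀ i (y : A i), (y : M) ∈ A 0 ⊓ A 1 → y ∈ (φ i).range :=
      fun i y hy => ⟨⟨y, hy⟩, rfl⟩
    let f : PushoutI φ →* M :=
      PushoutI.lift (fun i => (A i).subtype) (A 0 ⊓ A 1).subtype fun i => rfl
    have hfof : ∀ i (y : A i), f (PushoutI.of i y) = y := fun i y =>
      PushoutI.lift_of (fun i => (A i).subtype) _ _ y
    have hfbase : ∀ c, f (PushoutI.base φ c) = c := fun c =>
      PushoutI.lift_base (fun i => (A i).subtype) _ _ c
    have hsurj : Function.Surjective f := by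
      rw [← MonoidHom.range_eq_top, eq_top_iff, ← htop, Subgroup.closure_le]
      rintro x (hx | hx)
      · exact ⟨PushoutI.of 0 ⟨x, hx⟩, hfof _ _⟩
      · exact ⟨PushoutI.of 1 ⟨x, hx⟩, hfof _ _⟩
    have hinj : Function.Injective f := by
      rw [injective_iff_map_eq_one]
      intro x hx
      obtain ⟨c, w, hw, rfl⟩ := PushoutI.exists_prod_eq hφ x
      have hprod : f (PushoutI.ofCoprodI w.prod) = (w.toList.map fun p => (p.2 : M)).prod := by
        rw [CoprodI.Word.prod, map_list_prod, map_list_prod, List.map_map, List.map_map]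
        exact congrArg List.prod (List.map_congr_left fun p _ => by simp [hfof])
      rw [map_mul, hfbase, hprod, mul_eq_one_iff_inv_eq] at hx
      have hmem : (w.toList.map fun p => (p.2 : M)).prod ∈ A 0 ⊓ A 1 := hx ▸ inv_mem c.2
      have hnil : w.toList = [] := by
        by_contra hne
        exact hred _ ((List.isChain_map Sigma.fst).2 w.chain_ne) (by simpa using hne) _ hmem.1
          hmem.2 (isAmalgamWord_prod A _ fun p hp h => hw p hp (hrange _ _ h))
      have hw1 : w = .empty := CoprodI.Word.ext hnil
      subst hw1
      have hc : c = 1 := Subtype.ext (by simpa using hx)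
      simp [hc]
    refine ⟨fun i => A i, (A 0 ⊓ A 1 : Subgroup M), inferInstance, inferInstance, φ, hφ, ?_,
      ⟨(MulEquiv.ofBijective f ⟨hinj, hsurj⟩).symm⟩⟩
    intro i hi
    fin_cases i
    · obtain ⟨c, hc⟩ := hi ⟨x₀, hx₀⟩
      have hc' : (c : M) = x₀ := congrArg Subtype.val hc
      exact hx₀' (hc' ▸ c.2.2)
    · obtain ⟨c, hc⟩ := hi ⟨x₁, hx₁⟩
      have hc' : (c : M) = x₁ := congrArg Subtype.val hc
      exact hx₁' (hc' ▸ c.2.1)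

theorem PredDefinable.isAmalgamWord (l : List (Fin 2)) :
    PredDefinable.{u} fun _ _ P x => IsAmalgamWord (fun i => P i) l x := by
  induction l with
  | nil => exact fun m τ hτ => .eq hτ .one
  | cons i l ih =>
    intro m τ hτ
    refine .ex (.and (.and (.mem _ (.var _)) (.not (.and (.mem 0 (.var _)) (.mem 1 (.var _))))) ?_)
    exact .ex (.and (ih (.var _)) (.eq hτ.weaken.weaken (.mul (.var _) (.var _))))

/-- The subsets `P 0` and `P 1` of `M` are subgroups and `M` is their free product with
amalgamation, in a non-trivial way. -/
def AmalgamCondition (M : Type u) [Group M] (P : ℕ → Set M) : Prop :=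
  (IsSubgroupSet (P 0) ∧ IsSubgroupSet (P 1)) ∧ (∃ x, x ∈ P 0 ∧ ¬ x ∈ P 1) ∧
    (∃ x, x ∈ P 1 ∧ ¬ x ∈ P 0) ∧ Subgroup.closure (P 0 ∪ P 1) = ⊤ ∧
    ∀ l : List (Fin 2), l.IsChain (· ≠ ·) → l ≠ [] → ∀ x, x ∈ P 0 → x ∈ P 1 →
      ¬ IsAmalgamWord (fun i => P i) l x

theorem definable_amalgamCondition :
    Definable.{u} (n := 0) fun M _ P _ => AmalgamCondition M P := by
  refine .and (.and (.isSubgroupSet 0) (.isSubgroupSet 1)) (.and ?_ (.and ?_ (.and ?_ ?_)))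
  · exact .ex (.and (.mem _ (.var _)) (.not (.mem _ (.var _))))
  · exact .ex (.and (.mem _ (.var _)) (.not (.mem _ (.var _))))
  · exact .closure_eq_top fun _ _ h => .or (.mem 0 h) (.mem 1 h)
  · exact .iInf fun l => .imp (.const _) (.imp (.const _) (.all (.imp (.mem _ (.var _))
      (.imp (.mem _ (.var _)) (.not (PredDefinable.isAmalgamWord l (.var _)))))))

theorem isNontrivialAmalgam_iff_amalgamCondition (M : Type u) [Group M] :
    IsNontrivialAmalgam M ↔ ∃ P, AmalgamCondition M P := by
  rw [isNontrivialAmalgam_iff]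
  constructor
  · rintro ⟨A, h⟩
    have hP : ∀ i : Fin 2, (fun k : ℕ => (A (if k = 0 then 0 else 1) : Set M)) i = A i := by
      intro i
      fin_cases i <;> rfl
    -- Only the indices `0` and `1` matter; later predicates repeat `A 1`.
    refine ⟨fun k => A (if k = 0 then 0 else 1),
      ⟨isSubgroupSet_iff.2 ⟨_, rfl⟩, isSubgroupSet_iff.2 ⟨_, rfl⟩⟩, ?_⟩
    simp only [hP]
    exact h
  · rintro ⟨P, ⟨h₀, h₁⟩, h⟩
    obtain ⟨A₀, hA₀⟩ := isSubgroupSet_iff.1 h₀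
    obtain ⟨A₁, hA₁⟩ := isSubgroupSet_iff.1 h₁
    have hP : (fun i : Fin 2 => P i) = fun i => ((![A₀, A₁] i : Subgroup M) : Set M) := by
      ext i : 1
      fin_cases i
      · exact hA₀.symm
      · exact hA₁.symm
    rw [hP, ← hA₀, ← hA₁] at h
    exact ⟨![A₀, A₁], h⟩

end BountifulGroups

namespace BountifulGroups

/-! ### HNN-extensions -/

/-- The element `x` is a product of factors `t ^ u * b` with `t` in `T` and `b` in `B`, without
any subproduct `t ^ u * b * t ^ (-u)` where `b` is in `A u`; the list gives the exponents `u`. -/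
def IsBrittonWord {M : Type u} [Group M] (B : Set M) (A : ℤˣ → Set M) (T : Set M) :
    List ℤˣ → M → Prop
  | [], x => x = 1
  | u :: l, x => ∃ t ∈ T, ∃ b, (b ∈ B ∧ ∀ u', u' ∈ l.head? → b ∈ A u → u = u') ∧
      ∃ z, IsBrittonWord B A T l z ∧ x = t ^ (u : ℤ) * b * z

theorem isBrittonWord_prod {M : Type u} [Group M] (B : Subgroup M) (A : ℤˣ → Set M) (t : M)
    (l : List (ℤˣ × B)) (hl : l.IsChain fun a b => (a.2 : M) ∈ A a.1 → a.1 = b.1) :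
    IsBrittonWord (B : Set M) A {t} (l.map Prod.fst)
      (l.map fun p => t ^ (p.1 : ℤ) * (p.2 : M)).prod := by
  induction l with
  | nil => rfl
  | cons p l ih =>
    refine ⟨t, rfl, p.2, ⟨p.2.2, ?_⟩, _, ih hl.tail, by simp⟩
    cases l with
    | nil => simp
    | cons q l =>
      intro u' hu'
      obtain rfl : q.1 = u' := by simpa using hu'
      exact (List.isChain_cons_cons.1 hl).1

/-- Forwards, this is Britton's lemma. Backwards, conjugation by `t` is an isomorphism `A₁ ≃* A₂`,
and its HNN-extension maps onto `M`. If `c` times a reduced word goes to `1`, the word has value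
`c⁻¹` in `B` and so is empty; this is why values in `B`, and not only `1`, are excluded. -/
theorem isHNNExtension_iff (M : Type u) [Group M] :
    IsHNNExtension M ↔ ∃ (B A₁ A₂ : Subgroup M) (t : M), A₁ ≤ B ∧ A₂ ≤ B ∧
      (∀ x, x ∈ A₁ ↔ t * x * t⁻¹ ∈ A₂) ∧ Subgroup.closure ((B : Set M) ∪ {t}) = ⊤ ∧
      ∀ l : List ℤˣ, l ≠ [] → ∀ x ∈ B,
        ¬ IsBrittonWord (B : Set M) (fun u => HNNExtension.toSubgroup A₁ A₂ u) {t} l x := by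
  constructor
  · rintro ⟨B, _, A₁, A₂, φ, ⟨e⟩⟩
    let ψ : B →* M := (e.symm : HNNExtension B A₁ A₂ φ →* M).comp HNNExtension.of
    have hψ : Function.Injective ψ := e.symm.injective.comp (HNNExtension.of_injective φ)
    have heψ : ∀ b, e (ψ b) = HNNExtension.of b := fun b => e.apply_symm_apply _
    have hconj : ∀ a : A₁, e.symm HNNExtension.t * ψ a * (e.symm HNNExtension.t)⁻¹ = ψ (φ a) := by
      intro a
      apply e.injective
      simp [heψ, HNNExtension.equiv_eq_conj]
    refine ⟨ψ.range, A₁.map ψ, A₂.map ψ, e.symm HNNExtension.t, Subgroup.map_le_range _ _,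
      Subgroup.map_le_range _ _, fun x => ⟨?_, ?_⟩, ?_, ?_⟩
    · rintro ⟨a, ha, rfl⟩
      exact ⟨φ ⟨a, ha⟩, (φ ⟨a, ha⟩).2, (hconj ⟨a, ha⟩).symm⟩
    · rintro ⟨a, ha, hax⟩
      refine ⟨φ.symm ⟨a, ha⟩, (φ.symm ⟨a, ha⟩).2, ?_⟩
      have := hconj (φ.symm ⟨a, ha⟩)
      rw [φ.apply_symm_apply, hax] at this
      exact mul_left_cancel (mul_right_cancel this)
    · rw [Subgroup.eq_top_iff']
      intro x
      obtain ⟨x, rfl⟩ := e.symm.surjective x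
      induction x using HNNExtension.induction_on with
      | of b => exact Subgroup.subset_closure (Or.inl ⟨b, rfl⟩)
      | t => exact Subgroup.subset_closure (Or.inr rfl)
      | mul x y hx hy => exact map_mul e.symm x y ▸ mul_mem hx hy
      | inv x hx => exact map_inv e.symm x ▸ inv_mem hx
    · rintro l hne x ⟨b, rfl⟩ hw
      have key : ∀ (l : List ℤˣ) (x : M), IsBrittonWord (ψ.range : Set M)
          (fun u => HNNExtension.toSubgroup (A₁.map ψ) (A₂.map ψ) u) {e.symm HNNExtension.t} l x →
          ∃ w : List (ℤˣ × B), w.map Prod.fst = l ∧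
            w.IsChain (fun a b => a.2 ∈ HNNExtension.toSubgroup A₁ A₂ a.1 → a.1 = b.1) ∧
            e x = (w.map fun p => HNNExtension.t ^ (p.1 : ℤ) * HNNExtension.of p.2).prod := by
        intro l
        induction l with
        | nil =>
          intro x hx
          exact ⟨[], rfl, List.isChain_nil, by simp [show x = 1 from hx]⟩
        | cons u l ih =>
          rintro x ⟨_, rfl, _, ⟨⟨b, rfl⟩, hb⟩, z, hz, rfl⟩
          obtain ⟨w, rfl, hw, hw'⟩ := ih z hz
          refine ⟨(u, b) :: w, rfl, ?_, ?_⟩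
          · refine List.isChain_cons.2 ⟨fun p hp hbu => hb p.1 ?_ ?_, hw⟩
            · rw [List.head?_map]
              exact Option.mem_map_of_mem _ hp
            · obtain rfl | rfl := Int.units_eq_one_or u <;> exact ⟨b, hbu, rfl⟩
          · simp [hw', heψ]
      obtain ⟨w, rfl, hw, hw'⟩ := key l _ hw
      have := HNNExtension.ReducedWord.toList_eq_nil_of_mem_of_range φ ⟨1, w, hw⟩
        ⟨b, by simp [HNNExtension.NormalWord.ReducedWord.prod, ← hw', heψ]⟩
      exact hne (by rw [show w = [] from this]; rfl)
  · rintro ⟨B, A₁, A₂, t, h₁, h₂, hA, htop, hred⟩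
    have hA' : ∀ x, x ∈ A₂ ↔ t⁻¹ * x * t ∈ A₁ := by
      intro x
      rw [hA]
      simp [mul_assoc]
    let φ : A₁.subgroupOf B ≃* A₂.subgroupOf B :=
      { toFun := fun a => ⟨⟨t * a * t⁻¹, h₂ ((hA _).1 a.2)⟩, (hA _).1 a.2⟩
        invFun := fun a => ⟨⟨t⁻¹ * a * t, h₁ ((hA' _).1 a.2)⟩, (hA' _).1 a.2⟩
        left_inv := fun a => by ext; simp [mul_assoc]
        right_inv := fun a => by ext; simp [mul_assoc]
        map_mul' := fun a b => by ext; simp [mul_assoc] }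
    let f : HNNExtension B (A₁.subgroupOf B) (A₂.subgroupOf B) φ →* M :=
      HNNExtension.lift B.subtype t fun a => by simp [φ, mul_assoc]
    have hfof : ∀ b, f (HNNExtension.of b) = b := fun b => HNNExtension.lift_of _ _ _ b
    have hft : f HNNExtension.t = t := HNNExtension.lift_t _ _ _
    have hsurj : Function.Surjective f := by
      rw [← MonoidHom.range_eq_top, eq_top_iff, ← htop, Subgroup.closure_le]
      rintro x (hx | rfl)
      · exact ⟨HNNExtension.of ⟨x, hx⟩, hfof _⟩
      · exact ⟨HNNExtension.t, hft⟩
    have hinj : Function.Injective f := by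
      rw [injective_iff_map_eq_one]
      intro x hx
      obtain ⟨d⟩ := HNNExtension.NormalWord.TransversalPair.nonempty B (A₁.subgroupOf B)
        (A₂.subgroupOf B)
      obtain ⟨w, rfl⟩ := (HNNExtension.NormalWord.equiv φ d).symm.surjective x
      -- Of the normal form only reducedness is needed, so the transversal is forgotten.
      change HNNExtension.NormalWord.ReducedWord.prod φ w.toReducedWord = 1
      change f (HNNExtension.NormalWord.ReducedWord.prod φ w.toReducedWord) = 1 at hx
      generalize w.toReducedWord = w at hx
      obtain ⟨c, l, hl⟩ := w
      have hprod : f (l.map fun p => HNNExtension.t ^ (p.1 : ℤ) * HNNExtension.of p.2).prod =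
          (l.map fun p => t ^ (p.1 : ℤ) * (p.2 : M)).prod := by
        rw [map_list_prod, List.map_map]
        exact congrArg List.prod (List.map_congr_left fun p _ => by simp [hfof, hft])
      simp only [HNNExtension.NormalWord.ReducedWord.prod] at hx ⊢
      rw [map_mul, hfof, hprod, mul_eq_one_iff_inv_eq] at hx
      have hnil : l = [] := by
        by_contra hne
        refine hred (l.map Prod.fst) (by simpa using hne) _ (hx ▸ inv_mem c.2)
          (isBrittonWord_prod B _ t l (hl.imp fun a b hab ha => hab ?_))
        obtain ⟨u, a⟩ := a
        obtain rfl | rfl := Int.units_eq_one_or u <;> exact ha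
      subst hnil
      have hc : c = 1 := Subtype.ext (by simpa using hx)
      simp [hc]
    exact ⟨B, inferInstance, A₁.subgroupOf B, A₂.subgroupOf B, φ,
      ⟨(MulEquiv.ofBijective f ⟨hinj, hsurj⟩).symm⟩⟩

/-- Base, associated subgroups and stable letter are coded by the predicates `0`, `1`, `2`, `3`. The
language has no new constants, so the stable letter enters as an element of a set. -/
theorem PredDefinable.isBrittonWord (l : List ℤˣ) :
    PredDefinable.{u} fun _ _ P x =>
      IsBrittonWord (P 0) (fun u => P (if u = 1 then 1 else 2)) (P 3) l x := by
  induction l with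
  | nil => exact fun m τ hτ => .eq hτ .one
  | cons u l ih =>
    intro m τ hτ
    refine .ex (.and (.mem 3 (.var _)) (.ex (.and (.and (.mem 0 (.var _))
      (.iInf fun u' => .imp (.const _) (.imp (.mem _ (.var _)) (.const _)))) ?_)))
    refine .ex (.and (ih (.var _)) (.eq hτ.weaken.weaken.weaken (.mul (.mul ?_ (.var _)) (.var _))))
    -- The exponent is `1` or `-1`, so the power is the term `t` or `t⁻¹`.
    obtain rfl | rfl := Int.units_eq_one_or u
    · simpa using .var _
    · simpa using .inv (.var _)

/-- The group `M` is an HNN-extension with base group `P 0` along an isomorphism between its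
subgroups `P 1` and `P 2`, and the stable letter is the only element of `P 3`. -/
def HNNCondition (M : Type u) [Group M] (P : ℕ → Set M) : Prop :=
  (IsSubgroupSet (P 0) ∧ IsSubgroupSet (P 1) ∧ IsSubgroupSet (P 2)) ∧
    (∃ t, t ∈ P 3 ∧ (∀ s, s ∈ P 3 → s = t) ∧
      ∀ x, (x ∈ P 1 → t * x * t⁻¹ ∈ P 2) ∧ (t * x * t⁻¹ ∈ P 2 → x ∈ P 1)) ∧
    (∀ x, x ∈ P 1 → x ∈ P 0) ∧ (∀ x, x ∈ P 2 → x ∈ P 0) ∧ Subgroup.closure (P 0 ∪ P 3) = ⊤ ∧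
    ∀ l : List ℤˣ, l ≠ [] → ∀ x, x ∈ P 0 →
      ¬ IsBrittonWord (P 0) (fun u => P (if u = 1 then 1 else 2)) (P 3) l x

theorem definable_hnnCondition : Definable.{u} (n := 0) fun M _ P _ => HNNCondition M P := by
  refine .and (.and (.isSubgroupSet 0) (.and (.isSubgroupSet 1) (.isSubgroupSet 2)))
    (.and (.ex (.and (.mem 3 (.var _)) (.and ?_ (.all (.and ?_ ?_)))))
      (.and ?_ (.and ?_ (.and ?_ ?_))))
  · exact .all (.imp (.mem _ (.var _)) (.eq (.var _) (.var _)))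
  · exact .imp (.mem _ (.var _)) (.mem _ (.mul (.mul (.var _) (.var _)) (.inv (.var _))))
  · exact .imp (.mem _ (.mul (.mul (.var _) (.var _)) (.inv (.var _)))) (.mem _ (.var _))
  · exact .all (.imp (.mem _ (.var _)) (.mem _ (.var _)))
  · exact .all (.imp (.mem _ (.var _)) (.mem _ (.var _)))
  · exact .closure_eq_top fun _ _ h => .or (.mem 0 h) (.mem 3 h)
  · exact .iInf fun l => .imp (.const _) (.all (.imp (.mem _ (.var _))
      (.not (PredDefinable.isBrittonWord l (.var _)))))

theorem isHNNExtension_iff_hnnCondition (M : Type u) [Group M] :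
    IsHNNExtension M ↔ ∃ P, HNNCondition M P := by
  rw [isHNNExtension_iff]
  constructor
  · rintro ⟨B, A₁, A₂, t, h₁, h₂, hA, htop, hred⟩
    let P : ℕ → Set M
      | 0 => B
      | 1 => A₁
      | 2 => A₂
      | _ => {t}
    refine ⟨P, ⟨isSubgroupSet_iff.2 ⟨B, rfl⟩, isSubgroupSet_iff.2 ⟨A₁, rfl⟩,
      isSubgroupSet_iff.2 ⟨A₂, rfl⟩⟩, ⟨t, rfl, fun s hs => hs, fun x => ⟨(hA x).1, (hA x).2⟩⟩,
      h₁, h₂, htop, fun l hl x hx => ?_⟩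
    have hP : (fun u : ℤˣ => P (if u = 1 then 1 else 2)) =
        fun u => (HNNExtension.toSubgroup A₁ A₂ u : Set M) := by
      ext u : 1
      obtain rfl | rfl := Int.units_eq_one_or u <;> rfl
    rw [hP]
    exact hred l hl x hx
  · rintro ⟨P, ⟨hB, h₁, h₂⟩, ⟨t, ht, ht', hA⟩, h₁', h₂', htop, hred⟩
    obtain ⟨B, hB⟩ := isSubgroupSet_iff.1 hB
    obtain ⟨A₁, h₁⟩ := isSubgroupSet_iff.1 h₁
    obtain ⟨A₂, h₂⟩ := isSubgroupSet_iff.1 h₂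
    have hT : P 3 = {t} := Set.eq_singleton_iff_unique_mem.2 ⟨ht, ht'⟩
    have hP : (fun u : ℤˣ => P (if u = 1 then 1 else 2)) =
        fun u => (HNNExtension.toSubgroup A₁ A₂ u : Set M) := by
      ext u : 1
      obtain rfl | rfl := Int.units_eq_one_or u
      · exact h₁.symm
      · exact h₂.symm
    rw [hP] at hred
    rw [← h₁, ← h₂] at hA
    rw [← h₁, ← hB] at h₁'
    rw [← h₂, ← hB] at h₂'
    rw [hT, ← hB] at htop hred
    exact ⟨B, A₁, A₂, t, h₁', h₂', fun x => ⟨(hA x).1, (hA x).2⟩, htop, hred⟩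

/-! ### Axiomatizability of amalgams, HNN-extensions and their union -/

theorem isReductOfAxiomatizable_amalgam :
    IsReductOfAxiomatizable.{u} fun G _ => IsNontrivialAmalgam G :=
  definable_amalgamCondition.isReductOfAxiomatizable fun M _ =>
    isNontrivialAmalgam_iff_amalgamCondition M

theorem isReductOfAxiomatizable_hnn :
    IsReductOfAxiomatizable.{u} fun G _ => IsHNNExtension G :=
  definable_hnnCondition.isReductOfAxiomatizable fun M _ => isHNNExtension_iff_hnnCondition M

theorem isReductOfAxiomatizable_amalgam_or_hnn :
    IsReductOfAxiomatizable.{u} fun G _ => IsNontrivialAmalgam G ∨ IsHNNExtension G :=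
  (definable_amalgamCondition.or definable_hnnCondition).isReductOfAxiomatizable fun M _ => by
    rw [exists_or, ← isNontrivialAmalgam_iff_amalgamCondition, ← isHNNExtension_iff_hnnCondition]

end BountifulGroups

theorem mainTheorem2 :
    (IsReductOfAxiomatizable.{u} (fun G _ => ¬ StronglyBounded G) ∧
      IsReductOfAxiomatizable.{u} (fun G _ => CofinalityLeOmega G) ∧
      IsReductOfAxiomatizable.{u} (fun G _ => ¬ CayleyBounded G) ∧
      (IsReductOfAxiomatizable.{u} (fun G _ => IsNontrivialAmalgam G) ∧
        IsReductOfAxiomatizable.{u} (fun G _ => IsHNNExtension G) ∧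
        IsReductOfAxiomatizable.{u} (fun G _ => IsNontrivialAmalgam G ∨ IsHNNExtension G)) ∧
      IsReductOfAxiomatizable.{u} (fun G _ => MapsOntoInt G)) ∧
    (Bountiful.{u} (fun G _ => ¬ StronglyBounded G) ∧
      Bountiful.{u} (fun G _ => CofinalityLeOmega G) ∧
      Bountiful.{u} (fun G _ => ¬ CayleyBounded G) ∧
      (Bountiful.{u} (fun G _ => IsNontrivialAmalgam G) ∧
        Bountiful.{u} (fun G _ => IsHNNExtension G) ∧
        Bountiful.{u} (fun G _ => IsNontrivialAmalgam G ∨ IsHNNExtension G)) ∧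
      Bountiful.{u} (fun G _ => MapsOntoInt G)) ∧
    Bountiful.{u} (fun G _ => ¬ PropertyFA G) := by
  refine ⟨⟨isReductOfAxiomatizable_not_stronglyBounded, isReductOfAxiomatizable_cofinality,
    isReductOfAxiomatizable_not_cayleyBounded, ⟨isReductOfAxiomatizable_amalgam,
      isReductOfAxiomatizable_hnn, isReductOfAxiomatizable_amalgam_or_hnn⟩,
    isReductOfAxiomatizable_mapsOntoInt⟩, ?_, bountiful_not_propertyFA⟩
  exact ⟨isReductOfAxiomatizable_not_stronglyBounded.bountiful,
    isReductOfAxiomatizable_cofinality.bountiful,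
    isReductOfAxiomatizable_not_cayleyBounded.bountiful, ⟨isReductOfAxiomatizable_amalgam.bountiful,
      isReductOfAxiomatizable_hnn.bountiful, isReductOfAxiomatizable_amalgam_or_hnn.bountiful⟩,
    isReductOfAxiomatizable_mapsOntoInt.bountiful⟩
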